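/- For a finite graph $G$ and an integer $s\ge 1$, let $\alpha_s(G)$ denote the maximum number of vertices in a $K_s$-free induced subgraph of $G$. For a graph $H$ and a real number $f$, let $\mathbf{RT}_s(n,H,f)$ denote the maximum number of edges in an $H$-free graph $G$ on $n$ vertices with $\alpha_s(G)<f$, and put $\mathbf{RT}_s(n,H,f)=0$ if no such graph exists. **Theorem.** Let $\varepsilon>0$ and $\frac12<\delta<1$. Then there is an $s_0=s_0(\varepsilon,\delta)$ such that for every integer $s\ge s_0$, as $n\to\infty$, $$\mathbf{RT}_s(n,K_{s+1},n^{\delta})=\Omega\left(n^{1+\delta-\varepsilon}\right)\qquad\text{and}\qquad \mathbf{RT}_s(n,K_{s+1},n^{\delta})=O\left(n^{1+\delta}\right).$$ That is, for every such $s$ there are constants $c,C>0$ (which may depend on $s$, $\varepsilon$ and $\delta$) with $c\,n^{1+\delta-\varepsilon}\le \mathbf{RT}_s(n,K_{s+1},n^{\delta})\le C\,n^{1+\delta}$ for all sufficiently large $n$. -/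

import Mathlib

open Filter Asymptotics

/-- The `s`-independence number `α_s(G)` of a (finite) graph `G`: the maximum number of vertices in
a `K_s`-free induced subgraph of `G`. -/
noncomputable def sIndepNum {V : Type*} (s : ℕ) (G : SimpleGraph V) : ℕ :=
  sSup {k : ℕ | ∃ S : Finset V, (G.induce (S : Set V)).CliqueFree s ∧ S.card = k}

/-- The Ramsey-Turán number `RT_s(n, H, f)`: the maximum number of edges in an `H`-free graph `G` on
`n` vertices with `α_s(G) < f`. If there is no such graph, the value is `sSup ∅ = 0`. -/
noncomputable def ramseyTuran {W : Type*} (s n : ℕ) (H : SimpleGraph W) (f : ℝ) : ℕ :=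
  sSup {m : ℕ | ∃ G : SimpleGraph (Fin n),
    H.Free G ∧ (sIndepNum s G : ℝ) < f ∧ G.edgeSet.ncard = m}

/-!
The upper bound holds because in a `K_{s+1}`-free graph every neighbourhood is `K_s`-free, so all
degrees are below `n ^ δ`.

For the lower bound the heart is a random graph on the `p ^ 2` points of the affine plane over
`ZMod p`. Fix a set `A` of `k` slopes. Each point independently receives, for each slope in `A`, a
pair in `Fin b × Fin s`; two points on a line of slope `a ∈ A` are joined when their pairs for `a`
have equal first and distinct second entries. Every line thus carries a disjoint union of `b`
complete `s`-partite graphs.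

* No collinear set is a `K_{s+1}`. If a `K_{s+1}` is not collinear, it contains three points that do
  not lie on a common line with slope in `A`; each of its points is determined by the slopes that
  join it to these three, so at most `p ^ 6 * (k ^ 3) ^ s` such configurations exist. Each one forces
  `s` independent coincidences of first entries, hence has probability at most `b ^ (-s)`
  (`card_filter_not_cliqueFree_mul_pow_le`).
* A `K_s`-free set `S` misses one of the `s` second entries among its points with a given first
  entry on a given line. For a fixed choice of the missing colours this has
  probability `(1 - 1 / s) ^ (k * |S|)`, and there are only `s ^ (k * p * b)` choices
  (`card_filter_cliqueFree_mul_pow_le`).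

With `k` about `p ^ κ`, `b = k ^ 4` and `s ≥ 7 / κ` both failure probabilities are below `1 / 2`, which
gives a `K_{s+1}`-free graph on `N = p ^ 2` vertices with `α_s ≤ M`, where `M` is about
`p ^ (1 + 5 * κ)`. Since its independent sets are that small too, it has at least of order
`N ^ 2 / M` edges (`mul_card_le_two_mul_sum_degree`). Replacing vertices by independent sets of nearly
equal sizes yields graphs on any `n ≥ N` vertices with `α_s` of order at most `n * M / N` and at least
of order `n ^ 2 / M` edges (`exists_blowup`). Taking `p` about `n ^ γ` with `γ` slightly above `1 - δ`
makes the first quantity smaller than `n ^ δ` and the second at least `n ^ (1 + δ - ε)`; the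
assumption `1 / 2 < δ` is what allows `p ^ 2 ≤ n`.
-/

/-! ### Lines and the coloured affine plane -/

/-- The intercept of the line of slope `a` through the point `x` of the affine plane `F × F`, so that
`x` and `y` lie on a common line of slope `a` iff `intercept x a = intercept y a`. Vertical lines are
not used. -/
def intercept {F : Type*} [Field F] (x : F × F) (a : F) : F := x.2 - a * x.1

/-- Two lines of distinct slopes share at most one point. -/
theorem eq_of_intercept_eq {F : Type*} [Field F] {x y : F × F} {a a' : F} (h : a ≠ a')
    (h₁ : intercept x a = intercept y a) (h₂ : intercept x a' = intercept y a') : x = y := by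
  unfold intercept at h₁ h₂
  have h3 : (a - a') * (x.1 - y.1) = 0 := by linear_combination h₂ - h₁
  have h4 : x.1 = y.1 := by
    rcases mul_eq_zero.1 h3 with h5 | h5
    · exact absurd (sub_eq_zero.1 h5) h
    · exact sub_eq_zero.1 h5
  refine Prod.ext h4 ?_
  rw [h4] at h₁
  linear_combination h₁

/-- The graph on the affine plane defined by a colouring `χ` of the pairs (point, slope in `A`): two
points are adjacent if on some common line with slope in `A` they have the same cluster (first entry
of `χ`) and different colours (second entry). On each line it is a disjoint union of `b` complete
`s`-partite graphs. -/
def clusterGraph {F : Type*} [Field F] {b s : ℕ} (A : Finset F)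
    (χ : (F × F) × A → Fin b × Fin s) : SimpleGraph (F × F) where
  Adj x y := ∃ a : A, intercept x a = intercept y a ∧ (χ (x, a)).1 = (χ (y, a)).1 ∧
    (χ (x, a)).2 ≠ (χ (y, a)).2
  symm := ⟨fun _ _ ⟨a, h₁, h₂, h₃⟩ => ⟨a, h₁.symm, h₂.symm, h₃.symm⟩⟩
  loopless := ⟨fun _ ⟨_, _, _, h⟩ => h rfl⟩

/-- For a uniformly random `χ`, the coincidences `(χ i).1 = (χ (g i)).1` with `i ∈ J` have joint
probability at most `b ^ (-|J|)`, because `g` maps `J` outside `J`. -/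
theorem card_filter_fst_eq_mul_pow_le {I : Type*} [Fintype I] [DecidableEq I] {b s : ℕ}
    (J : Finset I) (g : I → I) (hg : ∀ i ∈ J, g i ∉ J) :
    (Finset.univ.filter fun χ : I → Fin b × Fin s => ∀ i ∈ J, (χ i).1 = (χ (g i)).1).card *
      b ^ J.card ≤ Fintype.card (I → Fin b × Fin s) := by
  have h1 : b ^ J.card = (Finset.univ : Finset (J → Fin b)).card := by simp
  -- Overwriting the first entries of a good `χ` on `J` by arbitrary values is injective: they can be
  -- recovered from the values of `χ` outside `J`.
  rw [h1, ← Finset.card_product, ← Finset.card_univ]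
  refine Finset.card_le_card_of_injOn
    (fun z i => if h : i ∈ J then (z.2 ⟨i, h⟩, (z.1 i).2) else z.1 i) (fun _ _ => by simp) ?_
  rintro ⟨χ, w⟩ h ⟨χ', w'⟩ h' he
  simp only [Finset.coe_product, Finset.coe_filter, Set.mem_prod, Set.mem_ofPred_eq,
    Finset.mem_univ, true_and] at h h'
  have hoff : ∀ i ∉ J, χ i = χ' i := fun i hi => by simpa [hi] using congrFun he i
  have hon : ∀ i, ∀ hi : i ∈ J, w ⟨i, hi⟩ = w' ⟨i, hi⟩ ∧ (χ i).2 = (χ' i).2 := fun i hi => by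
    simpa [hi] using congrFun he i
  refine Prod.ext (funext fun i => ?_) (funext fun i => (hon i i.2).1)
  by_cases hi : i ∈ J
  · refine Prod.ext ?_ (hon i hi).2
    change (χ i).1 = (χ' i).1
    rw [h.1 i hi, h'.1 i hi, hoff _ (hg i hi)]
  · exact hoff i hi

/-- For a uniformly random `χ`, the events `(χ i).2 ≠ f i (χ i).1` with `i ∈ J` are independent, each
of probability `1 - 1 / s`. -/
theorem card_filter_snd_ne_mul_pow {I : Type*} [Fintype I] [DecidableEq I] {b s : ℕ}
    (J : Finset I) (f : I → Fin b → Fin s) :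
    (Finset.univ.filter fun χ : I → Fin b × Fin s => ∀ i ∈ J, (χ i).2 ≠ f i (χ i).1).card *
      s ^ J.card = Fintype.card (I → Fin b × Fin s) * (s - 1) ^ J.card := by
  have hset : (Finset.univ.filter fun χ : I → Fin b × Fin s => ∀ i ∈ J, (χ i).2 ≠ f i (χ i).1) =
      Fintype.piFinset fun i => if i ∈ J then
        Finset.univ.filter fun z : Fin b × Fin s => z.2 ≠ f i z.1 else Finset.univ := by
    ext χ
    simp only [Finset.mem_filter, Finset.mem_univ, true_and, Fintype.mem_piFinset]
    refine forall_congr' fun i => ?_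
    by_cases hi : i ∈ J <;> simp [hi]
  have hcard : ∀ i, (Finset.univ.filter fun z : Fin b × Fin s => z.2 ≠ f i z.1).card =
      b * (s - 1) := fun i => by
    rw [Finset.card_filter, Fintype.sum_prod_type]
    simp only [← Finset.card_filter]
    simp [Finset.filter_ne']
  rw [hset, Fintype.card_piFinset]
  have h2 : ∀ i, (if i ∈ J then
      Finset.univ.filter fun z : Fin b × Fin s => z.2 ≠ f i z.1 else Finset.univ).card =
      if i ∈ J then b * (s - 1) else b * s := fun i => by
    split_ifs <;> simp [hcard]
  simp only [h2]
  rw [Finset.prod_ite]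
  simp only [Finset.prod_const, Fintype.card_fun, Fintype.card_prod, Fintype.card_fin]
  have h3 : (Finset.univ.filter fun i => i ∈ J).card = J.card := by simp
  have h4 : J.card + (Finset.univ.filter fun i => i ∉ J).card = Fintype.card I := by
    rw [← h3, Finset.card_filter_add_card_filter_not, Finset.card_univ]
  rw [← h4, h3, pow_add, mul_pow, mul_pow]
  ring

/-- A `K_s`-free point set misses one of the `s` colours on each cluster (set of points with a
common first entry) of each line; the line of slope `a` and intercept `c` is encoded as `(a, c)`. -/
theorem exists_missing_colour {F : Type*} [Field F] {b s : ℕ} {A : Finset F}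
    {χ : (F × F) × A → Fin b × Fin s} {S : Finset (F × F)}
    (h : ((clusterGraph A χ).induce (S : Set (F × F))).CliqueFree s) :
    ∃ f : A × F → Fin b → Fin s, ∀ x ∈ S, ∀ a : A,
      (χ (x, a)).2 ≠ f (a, intercept x a) (χ (x, a)).1 := by
  have key : ∀ (l : A × F) (β : Fin b), ∃ c : Fin s, ∀ x ∈ S, intercept x l.1 = l.2 →
      (χ (x, l.1)).1 = β → (χ (x, l.1)).2 ≠ c := by
    intro l β
    by_contra! hcon
    choose x hxS hxl hxβ hxc using hcon
    have hinj : Function.Injective x := fun c c' hc => by rw [← hxc c, ← hxc c', hc]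
    refine (SimpleGraph.cliqueFree_iff.1 h).false ⟨⟨fun c => ⟨x c, hxS c⟩, fun {c c'} hne => ?_⟩,
      fun c c' hc => hinj (Subtype.ext_iff.1 hc)⟩
    exact ⟨l.1, (hxl c).trans (hxl c').symm, (hxβ c).trans (hxβ c').symm,
      fun hcc => hne ((hxc c).symm.trans (hcc.trans (hxc c')))⟩
  choose f hf using key
  exact ⟨f, fun x hx a => hf (a, intercept x a) _ x hx rfl rfl⟩

open Classical in
/-- Union bound over `S` and over the choice of missing colours: the probability that some set of `m`
points is `K_s`-free is at most `q ^ (2 * m) * s ^ (k * q * b) * (1 - 1 / s) ^ (m * k)`, where `q = |F|` and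
`k = |A|`. -/
theorem card_filter_cliqueFree_mul_pow_le {F : Type*} [Field F] [Fintype F] (b s m : ℕ)
    (A : Finset F) :
    (Finset.univ.filter fun χ : (F × F) × A → Fin b × Fin s => ∃ S : Finset (F × F), S.card = m ∧
      ((clusterGraph A χ).induce (S : Set (F × F))).CliqueFree s).card * s ^ (m * A.card) ≤
    (Fintype.card F ^ 2) ^ m * s ^ (A.card * Fintype.card F * b) *
      (Fintype.card ((F × F) × A → Fin b × Fin s) * (s - 1) ^ (m * A.card)) := by
  set T : Finset (Finset (F × F) × (A × F → Fin b → Fin s)) :=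
    (Finset.univ.powersetCard m) ×ˢ Finset.univ with hT
  have hTcard : T.card ≤ (Fintype.card F ^ 2) ^ m * s ^ (A.card * Fintype.card F * b) := by
    rw [hT, Finset.card_product, Finset.card_powersetCard]
    refine Nat.mul_le_mul ((Nat.choose_le_pow _ _).trans_eq ?_) (le_of_eq ?_)
    · simp [sq]
    · simp [← pow_mul, mul_comm]
  have hsub : (Finset.univ.filter fun χ : (F × F) × A → Fin b × Fin s =>
      ∃ S : Finset (F × F), S.card = m ∧
        ((clusterGraph A χ).induce (S : Set (F × F))).CliqueFree s) ⊆
      T.biUnion fun z => Finset.univ.filter fun χ => ∀ i ∈ z.1 ×ˢ (Finset.univ : Finset A),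
        (χ i).2 ≠ z.2 (i.2, intercept i.1 i.2) (χ i).1 := by
    intro χ hχ
    obtain ⟨S, hS, hfree⟩ := (Finset.mem_filter.1 hχ).2
    obtain ⟨f, hf⟩ := exists_missing_colour hfree
    refine Finset.mem_biUnion.2 ⟨(S, f), ?_, ?_⟩
    · simp [hT, hS]
    · simp only [Finset.mem_filter, Finset.mem_univ, true_and]
      rintro ⟨x, a⟩ hx
      exact hf x (Finset.mem_product.1 hx).1 a
  have hone : ∀ z ∈ T, (Finset.univ.filter fun χ : (F × F) × A → Fin b × Fin s =>
      ∀ i ∈ z.1 ×ˢ (Finset.univ : Finset A),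
        (χ i).2 ≠ z.2 (i.2, intercept i.1 i.2) (χ i).1).card * s ^ (m * A.card) =
      Fintype.card ((F × F) × A → Fin b × Fin s) * (s - 1) ^ (m * A.card) := by
    intro z hz
    have hz1 : z.1.card = m := (Finset.mem_powersetCard.1 (Finset.mem_product.1 hz).1).2
    have := card_filter_snd_ne_mul_pow (z.1 ×ˢ (Finset.univ : Finset A))
      (fun i : (F × F) × A => z.2 (i.2, intercept i.1 i.2) : _ → Fin b → Fin s)
    simpa [Finset.card_product, hz1] using this
  calc _ ≤ (∑ z ∈ T, (Finset.univ.filter fun χ : (F × F) × A → Fin b × Fin s =>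
      ∀ i ∈ z.1 ×ˢ (Finset.univ : Finset A),
        (χ i).2 ≠ z.2 (i.2, intercept i.1 i.2) (χ i).1).card) * s ^ (m * A.card) :=
        Nat.mul_le_mul_right _ ((Finset.card_le_card hsub).trans Finset.card_biUnion_le)
    _ = T.card * (Fintype.card ((F × F) × A → Fin b × Fin s) * (s - 1) ^ (m * A.card)) := by
        rw [Finset.sum_mul, Finset.sum_congr rfl hone, Finset.sum_const, smul_eq_mul]
    _ ≤ _ := Nat.mul_le_mul_right _ hTcard

open Classical in
/-- If no line with slope in `A` contains the three points, then a point joined to all of them by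
such lines is determined by the three slopes: they are not all equal, so two of the lines meet in a
single point. -/
theorem card_joined_le {F : Type*} [Field F] [Fintype F] (A : Finset F) {P₁ P₂ P₃ : F × F}
    (h : ∀ a ∈ A, intercept P₁ a = intercept P₂ a → intercept P₁ a ≠ intercept P₃ a) :
    (Finset.univ.filter fun x : F × F => ∀ P ∈ ({P₁, P₂, P₃} : Finset (F × F)),
      ∃ a ∈ A, intercept x a = intercept P a).card ≤ A.card ^ 3 := by
  have hA : A.card ^ 3 = (A ×ˢ A ×ˢ A).card := by
    simp only [Finset.card_product]; ring
  rw [hA]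
  refine Finset.card_le_card_of_forall_subsingleton
    (fun x z => intercept x z.1 = intercept P₁ z.1 ∧ intercept x z.2.1 = intercept P₂ z.2.1 ∧
      intercept x z.2.2 = intercept P₃ z.2.2) ?_ ?_
  · intro x hx
    have hx := (Finset.mem_filter.1 hx).2
    obtain ⟨a₁, h₁, e₁⟩ := hx P₁ (by simp)
    obtain ⟨a₂, h₂, e₂⟩ := hx P₂ (by simp)
    obtain ⟨a₃, h₃, e₃⟩ := hx P₃ (by simp)
    exact ⟨(a₁, a₂, a₃), by simp [h₁, h₂, h₃], e₁, e₂, e₃⟩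
  · rintro ⟨a₁, a₂, a₃⟩ hz x ⟨-, hx₁, hx₂, hx₃⟩ y ⟨-, hy₁, hy₂, hy₃⟩
    simp only [Finset.mem_product] at hz hx₁ hx₂ hx₃ hy₁ hy₂ hy₃
    by_cases h12 : a₁ = a₂
    · by_cases h13 : a₁ = a₃
      · subst h12 h13
        exact absurd (hx₁.symm.trans hx₃) (h a₁ hz.1 (hx₁.symm.trans hx₂))
      · exact eq_of_intercept_eq h13 (hx₁.trans hy₁.symm) (hx₃.trans hy₃.symm)
    · exact eq_of_intercept_eq h12 (hx₁.trans hy₁.symm) (hx₂.trans hy₂.symm)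

open Classical in
/-- The probability that `P` is adjacent to all points of `Y` is at most `b ^ (-|Y|)`: each adjacency
forces a coincidence of first entries for the unique slope joining the two points. -/
theorem card_filter_star_mul_pow_le {F : Type*} [Field F] [Fintype F] {b s : ℕ} (A : Finset F)
    (P : F × F) (Y : Finset (F × F)) (hP : P ∉ Y) :
    (Finset.univ.filter fun χ : (F × F) × A → Fin b × Fin s =>
      ∀ y ∈ Y, (clusterGraph A χ).Adj y P).card * b ^ Y.card ≤
      Fintype.card ((F × F) × A → Fin b × Fin s) := by
  by_cases hcol : ∀ y ∈ Y, ∃ a : A, intercept y a = intercept P a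
  · choose α hα using hcol
    set J : Finset ((F × F) × A) := Y.attach.image fun y => (y.1, α y.1 y.2) with hJ
    have hJcard : J.card = Y.card := by
      rw [hJ, Finset.card_image_of_injective _ (fun y y' h => Subtype.ext (Prod.ext_iff.1 h).1),
        Finset.card_attach]
    rw [← hJcard]
    refine le_trans (Nat.mul_le_mul_right _ (Finset.card_le_card ?_))
      (card_filter_fst_eq_mul_pow_le J (fun i => (P, i.2)) ?_)
    · intro χ hχ
      simp only [Finset.mem_filter, Finset.mem_univ, true_and] at hχ ⊢
      intro i hi
      obtain ⟨y, -, rfl⟩ := Finset.mem_image.1 hi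
      obtain ⟨a, h₁, h₂, -⟩ := hχ y.1 y.2
      have : a = α y.1 y.2 := by
        by_contra hne
        exact hP (eq_of_intercept_eq (fun h => hne (Subtype.ext h)) h₁ (hα y.1 y.2) ▸ y.2)
      simpa [this] using h₂
    · intro i hi hi'
      obtain ⟨y, -, hy⟩ := Finset.mem_image.1 hi'
      have : y.1 = P := (Prod.ext_iff.1 hy).1
      exact hP (this ▸ y.2)
  · have : (Finset.univ.filter fun χ : (F × F) × A → Fin b × Fin s =>
      ∀ y ∈ Y, (clusterGraph A χ).Adj y P) = ∅ := by
      refine Finset.filter_eq_empty_iff.2 fun χ _ hχ => hcol fun y hy => ?_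
      obtain ⟨a, h, -⟩ := hχ y hy
      exact ⟨a, h⟩
    rw [this, Finset.card_empty, zero_mul]
    exact Nat.zero_le _

/-- A clique on `s + 1` vertices is not contained in a line, since adjacent points of a line have
distinct colours among `s`. -/
theorem exists_noncollinear_of_isNClique {F : Type*} [Field F] {b s : ℕ} {A : Finset F}
    {χ : (F × F) × A → Fin b × Fin s} (hs : 1 ≤ s) {Q : Finset (F × F)}
    (hQ : (clusterGraph A χ).IsNClique (s + 1) Q) :
    ∃ P₁ ∈ Q, ∃ P₂ ∈ Q, ∃ P₃ ∈ Q, ∀ a ∈ A, intercept P₁ a = intercept P₂ a →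
      intercept P₁ a ≠ intercept P₃ a := by
  obtain ⟨P₁, h₁, P₂, h₂, hne⟩ := Finset.one_lt_card.1 (by rw [hQ.card_eq]; omega : 1 < Q.card)
  by_contra! hcon
  obtain ⟨a, ha, -⟩ := hQ.isClique h₁ h₂ hne
  -- Otherwise all of `Q` lies on the line through `P₁` and `P₂`, and the colours there are distinct.
  have hline : ∀ x ∈ Q, intercept P₁ a = intercept x a := by
    intro x hx
    obtain ⟨a', ha', h12, h13⟩ := hcon P₁ h₁ P₂ h₂ x hx
    have : a' = a := by
      by_contra h
      exact hne (eq_of_intercept_eq h h12 ha)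
    rwa [← this]
  have hinj : Set.InjOn (fun x => (χ (x, a)).2) (Q : Set (F × F)) := by
    intro x hx y hy hxy
    by_contra hne'
    obtain ⟨a', h1, -, h3⟩ := hQ.isClique hx hy hne'
    have : a' = a := by
      by_contra h
      exact hne' (eq_of_intercept_eq (fun h' => h (Subtype.ext h')) h1
        ((hline x hx).symm.trans (hline y hy)))
    subst this
    exact h3 hxy
  have := Finset.card_le_card_of_injOn (t := Finset.univ) _ (fun _ _ => by simp) hinj
  rw [hQ.card_eq, Finset.card_univ, Fintype.card_fin] at this
  omega

open Classical in
/-- Union bound over a noncollinear triple of the clique and over its remaining vertices: the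
probability that a `K_{s+1}` occurs is at most `q ^ 6 * (k ^ 3) ^ s / b ^ s`, where `q = |F|` and
`k = |A|`. -/
theorem card_filter_not_cliqueFree_mul_pow_le {F : Type*} [Field F] [Fintype F] {b s : ℕ}
    (hs : 1 ≤ s) (A : Finset F) :
    (Finset.univ.filter fun χ : (F × F) × A → Fin b × Fin s =>
      ¬ (clusterGraph A χ).CliqueFree (s + 1)).card * b ^ s ≤
    Fintype.card F ^ 6 * (A.card ^ 3) ^ s * Fintype.card ((F × F) × A → Fin b × Fin s) := by
  set N : Finset ((F × F) × (F × F) × (F × F)) := Finset.univ.filter fun t => ∀ a ∈ A,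
    intercept t.1 a = intercept t.2.1 a → intercept t.1 a ≠ intercept t.2.2 a with hN
  set X : (F × F) × (F × F) × (F × F) → Finset (F × F) := fun t => Finset.univ.filter
    fun x => ∀ P ∈ ({t.1, t.2.1, t.2.2} : Finset (F × F)), ∃ a ∈ A, intercept x a = intercept P a
    with hX
  -- A clique `Q` is recorded by a noncollinear triple in it and by `Q` without the first point of the
  -- triple, which is adjacent to the `s` others.
  set T := N.sigma fun t => ((X t).erase t.1).powersetCard s with hT
  have hTcard : T.card ≤ Fintype.card F ^ 6 * (A.card ^ 3) ^ s := by
    rw [hT, Finset.card_sigma]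
    have hle : ∀ t ∈ N, (((X t).erase t.1).powersetCard s).card ≤ (A.card ^ 3) ^ s := by
      intro t ht
      rw [Finset.card_powersetCard]
      refine (Nat.choose_le_pow _ _).trans (Nat.pow_le_pow_left ?_ _)
      exact (Finset.card_le_card (Finset.erase_subset _ _)).trans
        (card_joined_le A (Finset.mem_filter.1 ht).2)
    refine (Finset.sum_le_card_nsmul _ _ _ hle).trans ?_
    rw [smul_eq_mul]
    refine Nat.mul_le_mul_right _ ((Finset.card_le_univ _).trans_eq ?_)
    simp only [Fintype.card_prod]; ring
  have hsub : (Finset.univ.filter fun χ : (F × F) × A → Fin b × Fin s =>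
      ¬ (clusterGraph A χ).CliqueFree (s + 1)) ⊆
      T.biUnion fun z => Finset.univ.filter fun χ => ∀ y ∈ z.2,
        (clusterGraph A χ).Adj y z.1.1 := by
    intro χ hχ
    have hχ := (Finset.mem_filter.1 hχ).2
    simp only [SimpleGraph.CliqueFree, not_forall, not_not] at hχ
    obtain ⟨Q, hQ⟩ := hχ
    obtain ⟨P₁, h₁, P₂, h₂, P₃, h₃, hnc⟩ := exists_noncollinear_of_isNClique hs hQ
    have hadj : ∀ y ∈ Q, ∀ P ∈ Q, y ≠ P → (clusterGraph A χ).Adj y P :=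
      fun y hy P hP hne => hQ.isClique hy hP hne
    have hAne : A.Nonempty := by
      obtain ⟨x, hx, y, hy, hne⟩ :=
        Finset.one_lt_card.1 (by rw [hQ.card_eq]; omega : 1 < Q.card)
      obtain ⟨a, -⟩ := hadj x hx y hy hne
      exact ⟨a, a.2⟩
    refine Finset.mem_biUnion.2 ⟨⟨(P₁, P₂, P₃), Q.erase P₁⟩, ?_, ?_⟩
    · rw [hT, Finset.mem_sigma, Finset.mem_powersetCard]
      refine ⟨by simpa [hN] using hnc, Finset.erase_subset_erase _ ?_, ?_⟩
      · intro x hx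
        simp only [hX, Finset.mem_filter, Finset.mem_univ, true_and]
        intro P hP
        have hPQ : P ∈ Q := by
          simp only [Finset.mem_insert, Finset.mem_singleton] at hP
          rcases hP with rfl | rfl | rfl <;> assumption
        by_cases hxP : x = P
        · obtain ⟨a, ha⟩ := hAne
          exact ⟨a, ha, by rw [hxP]⟩
        · obtain ⟨a, ha, -⟩ := hadj x hx P hPQ hxP
          exact ⟨a, a.2, ha⟩
      · rw [Finset.card_erase_of_mem h₁, hQ.card_eq]; rfl
    · simp only [Finset.mem_filter, Finset.mem_univ, true_and]
      intro y hy
      exact hadj y (Finset.mem_of_mem_erase hy) P₁ h₁ (Finset.ne_of_mem_erase hy)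
  have hone : ∀ z ∈ T, (Finset.univ.filter fun χ : (F × F) × A → Fin b × Fin s => ∀ y ∈ z.2,
        (clusterGraph A χ).Adj y z.1.1).card * b ^ s ≤
      Fintype.card ((F × F) × A → Fin b × Fin s) := by
    intro z hz
    rw [hT, Finset.mem_sigma, Finset.mem_powersetCard] at hz
    have := card_filter_star_mul_pow_le (b := b) (s := s) A z.1.1 z.2
      (fun h => Finset.notMem_erase _ _ (hz.2.1 h))
    rwa [hz.2.2] at this
  calc _ ≤ (∑ z ∈ T, (Finset.univ.filter fun χ : (F × F) × A → Fin b × Fin s => ∀ y ∈ z.2,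
        (clusterGraph A χ).Adj y z.1.1).card) * b ^ s :=
        Nat.mul_le_mul_right _ ((Finset.card_le_card hsub).trans Finset.card_biUnion_le)
    _ ≤ T.card * Fintype.card ((F × F) × A → Fin b × Fin s) := by
        rw [Finset.sum_mul, ← smul_eq_mul]
        exact Finset.sum_le_card_nsmul _ _ _ hone
    _ ≤ _ := Nat.mul_le_mul_right _ hTcard

/-- If both failure probabilities are below `1 / 2`, some colouring gives a `K_{s+1}`-free graph in
which every set of `m` points contains a `K_s`. -/
theorem exists_cliqueFree_of_card_bounds {F : Type*} [Field F] [Fintype F] {b s m : ℕ}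
    (hs : 1 ≤ s) (hb : 1 ≤ b) (A : Finset F)
    (h₁ : 2 * (Fintype.card F ^ 6 * (A.card ^ 3) ^ s) < b ^ s)
    (h₂ : 2 * ((Fintype.card F ^ 2) ^ m * s ^ (A.card * Fintype.card F * b) *
      (s - 1) ^ (m * A.card)) < s ^ (m * A.card)) :
    ∃ G : SimpleGraph (F × F), G.CliqueFree (s + 1) ∧
      ∀ S : Finset (F × F), (G.induce (S : Set (F × F))).CliqueFree s → S.card < m := by
  classical
  have hB := card_filter_not_cliqueFree_mul_pow_le (b := b) hs A
  have hA := card_filter_cliqueFree_mul_pow_le b s m A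
  set Ω := Fintype.card ((F × F) × A → Fin b × Fin s) with hΩ
  set B₁ := Finset.univ.filter fun χ : (F × F) × A → Fin b × Fin s =>
      ¬ (clusterGraph A χ).CliqueFree (s + 1)
  set B₂ := Finset.univ.filter fun χ : (F × F) × A → Fin b × Fin s =>
    ∃ S : Finset (F × F), S.card = m ∧
      ((clusterGraph A χ).induce (S : Set (F × F))).CliqueFree s
  have hΩpos : 0 < Ω := by
    have : Nonempty (Fin b × Fin s) := ⟨(⟨0, hb⟩, ⟨0, hs⟩)⟩
    exact Fintype.card_pos
  have e₁ : 2 * B₁.card < Ω := by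
    refine lt_of_mul_lt_mul_right (a := b ^ s) ?_ (Nat.zero_le _)
    nlinarith [Nat.mul_lt_mul_of_pos_right h₁ hΩpos]
  have e₂ : 2 * B₂.card < Ω := by
    refine lt_of_mul_lt_mul_right (a := s ^ (m * A.card)) ?_ (Nat.zero_le _)
    have := Nat.mul_lt_mul_of_pos_right h₂ hΩpos
    calc 2 * B₂.card * s ^ (m * A.card) = 2 * (B₂.card * s ^ (m * A.card)) := by ring
      _ ≤ _ := Nat.mul_le_mul_left _ hA
      _ = _ := by ring
      _ < _ := this
      _ = _ := by ring
  have hex : ∃ χ, χ ∉ B₁ ∪ B₂ := by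
    by_contra! hall
    have : Ω ≤ (B₁ ∪ B₂).card := by
      rw [hΩ, ← Finset.card_univ]
      exact Finset.card_le_card fun χ _ => hall χ
    have := Finset.card_union_le B₁ B₂
    omega
  obtain ⟨χ, hχ⟩ := hex
  simp only [Finset.mem_union, not_or, B₁, B₂, Finset.mem_filter, Finset.mem_univ, true_and,
    not_not, not_exists, not_and] at hχ
  refine ⟨clusterGraph A χ, hχ.1, fun S hS => ?_⟩
  by_contra! hm
  obtain ⟨S', hS', hcard⟩ := Finset.exists_subset_card_eq hm
  exact hχ.2 S' hcard (hS.comap (SimpleGraph.induceHomOfLE _ (Finset.coe_subset.2 hS')).isContained)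

/-! ### Independence numbers and edge counts -/

theorem induce_cliqueFree_iff_cliqueFreeOn {V : Type*} (G : SimpleGraph V) (S : Set V) (n : ℕ) :
    (G.induce S).CliqueFree n ↔ G.CliqueFreeOn S n := by
  classical
  constructor
  · intro h t ht hc
    refine h (t.subtype (· ∈ S)) ⟨fun x hx y hy hxy => ?_, ?_⟩
    · exact hc.isClique (Finset.mem_subtype.1 hx) (Finset.mem_subtype.1 hy)
        fun h' => hxy (Subtype.ext h')
    · rw [Finset.card_subtype, Finset.filter_true_of_mem fun x hx => ht hx, hc.card_eq]
  · intro h t hc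
    refine h (t := t.map (Function.Embedding.subtype _)) (fun x hx => ?_)
      ((hc.map (f := Function.Embedding.subtype _)).mono ?_)
    · obtain ⟨y, -, rfl⟩ := Finset.mem_map.1 hx
      exact y.2
    · exact SimpleGraph.map_comap_le _ _

theorem sIndepNum_le {V : Type*} {s : ℕ} {G : SimpleGraph V} {k : ℕ}
    (h : ∀ S : Finset V, G.CliqueFreeOn (S : Set V) s → S.card ≤ k) : sIndepNum s G ≤ k := by
  refine csSup_le' ?_
  rintro _ ⟨S, hS, rfl⟩
  exact h S ((induce_cliqueFree_iff_cliqueFreeOn _ _ _).1 hS)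

theorem card_le_sIndepNum {V : Type*} [Fintype V] {s : ℕ} {G : SimpleGraph V} {S : Finset V}
    (h : G.CliqueFreeOn (S : Set V) s) : S.card ≤ sIndepNum s G := by
  refine le_csSup ⟨Fintype.card V, ?_⟩ ⟨S, (induce_cliqueFree_iff_cliqueFreeOn _ _ _).2 h, rfl⟩
  rintro _ ⟨S', -, rfl⟩
  exact S'.card_le_univ

theorem le_ramseyTuran {W : Type*} {s n : ℕ} {H : SimpleGraph W} {f : ℝ}
    {G : SimpleGraph (Fin n)} (hG : H.Free G) (hf : (sIndepNum s G : ℝ) < f) :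
    G.edgeSet.ncard ≤ ramseyTuran s n H f := by
  refine le_csSup ⟨(Set.univ : Set (Sym2 (Fin n))).ncard, ?_⟩ ⟨G, hG, hf, rfl⟩
  rintro _ ⟨G', -, -, rfl⟩
  exact Set.ncard_le_ncard (Set.subset_univ _)

theorem free_completeGraph_fin_iff {V : Type*} (G : SimpleGraph V) (r : ℕ) :
    (SimpleGraph.completeGraph (Fin r)).Free G ↔ G.CliqueFree r := by
  rw [← SimpleGraph.cliqueFree_iff_top_free, Fintype.card_fin]

theorem sum_degree_eq_two_mul_ncard {V : Type*} [Fintype V] (G : SimpleGraph V)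
    [DecidableRel G.Adj] : ∑ v, G.degree v = 2 * G.edgeSet.ncard := by
  classical
  rw [G.sum_degrees_eq_twice_card_edges, ← SimpleGraph.coe_edgeFinset, Set.ncard_coe_finset]

theorem degree_le_sIndepNum {V : Type*} [Fintype V] {s : ℕ} {G : SimpleGraph V}
    [DecidableRel G.Adj] (hG : G.CliqueFree (s + 1)) (v : V) : G.degree v ≤ sIndepNum s G := by
  classical
  refine card_le_sIndepNum fun t ht hc => hG (insert v t) (hc.insert fun w hw => ?_)
  simpa using ht hw

/-- Every neighbourhood in a `K_{s+1}`-free graph is `K_s`-free, so all degrees are below `f`. -/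
theorem ramseyTuran_le {s n : ℕ} {f : ℝ} (hf : 0 ≤ f) :
    (ramseyTuran s n (SimpleGraph.completeGraph (Fin (s + 1))) f : ℝ) ≤ n * f := by
  classical
  rw [← Nat.le_floor_iff (by positivity)]
  refine csSup_le' ?_
  rintro _ ⟨G, hG, hα, rfl⟩
  rw [Nat.le_floor_iff (by positivity)]
  rw [free_completeGraph_fin_iff] at hG
  have h1 : 2 * G.edgeSet.ncard ≤ n * sIndepNum s G := by
    rw [← sum_degree_eq_two_mul_ncard]
    refine (Finset.sum_le_card_nsmul _ _ _ fun v _ => degree_le_sIndepNum hG v).trans_eq ?_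
    simp
  have h2 : (G.edgeSet.ncard : ℝ) ≤ n * sIndepNum s G := by
    exact_mod_cast (by omega : G.edgeSet.ncard ≤ n * sIndepNum s G)
  exact h2.trans (mul_le_mul_of_nonneg_left hα.le (Nat.cast_nonneg _))

/-- A graph whose independent sets have at most `m` vertices has average degree at least `d / 2` if
`2 * m * d` is at most the number of vertices: a maximal independent set among the vertices of degree
less than `d` dominates them, so there are at most `m * d` of these. -/
theorem mul_card_le_two_mul_sum_degree {V : Type*} [Fintype V] (G : SimpleGraph V)
    [DecidableRel G.Adj] {m d : ℕ}
    (hG : ∀ I : Finset V, (∀ x ∈ I, ∀ y ∈ I, ¬ G.Adj x y) → I.card ≤ m)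
    (hd : 2 * (m * d) ≤ Fintype.card V) : d * Fintype.card V ≤ 2 * ∑ v, G.degree v := by
  classical
  set D := Finset.univ.filter fun v => G.degree v < d with hD
  have hDcard : D.card ≤ m * d := by
    obtain ⟨I, hI, hmax⟩ := (D.powerset.filter fun I =>
      ∀ x ∈ I, ∀ y ∈ I, ¬ G.Adj x y).exists_max_image Finset.card ⟨∅, by simp⟩
    simp only [Finset.mem_filter, Finset.mem_powerset] at hI hmax
    have hcover : D ⊆ I.biUnion fun v => insert v (G.neighborFinset v) := by
      intro w hw
      by_contra hcon
      simp only [Finset.mem_biUnion, Finset.mem_insert, SimpleGraph.mem_neighborFinset, not_exists,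
        not_and, not_or] at hcon
      have hwI : w ∉ I := fun h => (hcon w h).1 rfl
      have := hmax (insert w I) ⟨Finset.insert_subset hw hI.1, ?_⟩
      · rw [Finset.card_insert_of_notMem hwI] at this
        omega
      · intro x hx y hy
        rcases Finset.mem_insert.1 hx with rfl | hx' <;>
          rcases Finset.mem_insert.1 hy with rfl | hy'
        · exact G.loopless.irrefl _
        · exact fun h => (hcon y hy').2 h.symm
        · exact (hcon x hx').2
        · exact hI.2 x hx' y hy'
    calc D.card ≤ ∑ v ∈ I, (insert v (G.neighborFinset v)).card :=
          (Finset.card_le_card hcover).trans Finset.card_biUnion_le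
      _ ≤ I.card * d := by
          refine Finset.sum_le_card_nsmul _ _ _ fun v hv => (Finset.card_insert_le _ _).trans ?_
          rw [SimpleGraph.card_neighborFinset_eq_degree]
          exact (Finset.mem_filter.1 (hI.1 hv)).2
      _ ≤ m * d := Nat.mul_le_mul_right _ (hG I hI.2)
  have h1 : (Finset.univ \ D).card * d ≤ ∑ v, G.degree v := by
    refine le_trans ?_ (Finset.sum_le_sum_of_subset (Finset.sdiff_subset (s := Finset.univ) (t := D)))
    rw [← smul_eq_mul]
    refine Finset.card_nsmul_le_sum _ _ _ fun v hv => ?_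
    simpa [hD] using hv
  have h2 : Fintype.card V ≤ 2 * (Finset.univ \ D).card := by
    rw [Finset.card_sdiff_of_subset (Finset.subset_univ _), Finset.card_univ]
    omega
  calc d * Fintype.card V ≤ d * (2 * (Finset.univ \ D).card) := Nat.mul_le_mul_left _ h2
    _ = 2 * ((Finset.univ \ D).card * d) := by ring
    _ ≤ _ := Nat.mul_le_mul_left _ h1

theorem cliqueFree_comap {V W : Type*} {G : SimpleGraph V} {r : ℕ} (h : G.CliqueFree r)
    (π : W → V) : (G.comap π).CliqueFree r := by
  classical
  intro t ht
  have hinj : Set.InjOn π t := fun x hx y hy hxy => by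
    by_contra hne
    have hadj : G.Adj (π x) (π y) := ht.isClique hx hy hne
    exact hadj.ne hxy
  refine h (t.image π) ⟨?_, by rw [Finset.card_image_of_injOn hinj, ht.card_eq]⟩
  intro x hx y hy hxy
  obtain ⟨x, hx', rfl⟩ := Finset.mem_image.1 hx
  obtain ⟨y, hy', rfl⟩ := Finset.mem_image.1 hy
  exact ht.isClique hx' hy' fun h => hxy (h ▸ rfl)

theorem cliqueFreeOn_image_of_comap {V W : Type*} [DecidableEq V] {G : SimpleGraph V} {r : ℕ}
    (π : W → V) {S : Finset W} (h : (G.comap π).CliqueFreeOn (S : Set W) r) :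
    G.CliqueFreeOn (S.image π : Set V) r := by
  classical
  intro t ht hc
  have hpre : ∀ v ∈ t, ∃ w ∈ S, π w = v := fun v hv => by simpa using ht hv
  choose g hgS hg using hpre
  have hinj : ∀ x hx y hy, g x hx = g y hy → x = y := fun x hx y hy h => by
    rw [← hg x hx, ← hg y hy, h]
  refine h (t := t.attach.image fun v => g v.1 v.2) (fun w hw => ?_)
    ⟨fun x hx y hy hxy => ?_, ?_⟩
  · obtain ⟨v, -, rfl⟩ := Finset.mem_image.1 hw
    exact hgS v.1 v.2
  · obtain ⟨x, -, rfl⟩ := Finset.mem_image.1 hx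
    obtain ⟨y, -, rfl⟩ := Finset.mem_image.1 hy
    change G.Adj (π (g x.1 x.2)) (π (g y.1 y.2))
    rw [hg, hg]
    exact hc.isClique x.2 y.2 fun h => hxy (by rw [Subtype.ext h])
  · rw [Finset.card_image_of_injective _ fun x y hxy => Subtype.ext (hinj _ _ _ _ hxy),
      Finset.card_attach, hc.card_eq]

theorem sIndepNum_comap_le {V W : Type*} [Fintype V] [Fintype W] [DecidableEq V]
    {G : SimpleGraph V} {s B : ℕ} (π : W → V)
    (hB : ∀ v, (Finset.univ.filter fun w => π w = v).card ≤ B) :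
    sIndepNum s (G.comap π) ≤ B * sIndepNum s G := by
  refine sIndepNum_le fun S hS => ?_
  refine (Finset.card_le_mul_card_image S B fun v _ => ?_).trans
    (Nat.mul_le_mul_left _ (card_le_sIndepNum (cliqueFreeOn_image_of_comap π hS)))
  exact (Finset.card_le_card (Finset.filter_subset_filter _ (Finset.subset_univ _))).trans (hB v)

theorem sq_mul_sum_degree_le_sum_degree_comap {V W : Type*} [Fintype V] [Fintype W]
    [DecidableEq V] {G : SimpleGraph V} [DecidableRel G.Adj] {B : ℕ} (π : W → V)
    [DecidableRel (G.comap π).Adj]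
    (hB : ∀ v, B ≤ (Finset.univ.filter fun w => π w = v).card) :
    B ^ 2 * ∑ v, G.degree v ≤ ∑ w, (G.comap π).degree w := by
  classical
  have hdeg : ∀ w, B * G.degree (π w) ≤ (G.comap π).degree w := by
    intro w
    have h1 : (G.comap π).neighborFinset w =
        (G.neighborFinset (π w)).biUnion fun v => Finset.univ.filter fun w' => π w' = v := by
      ext w'
      simp
    rw [← SimpleGraph.card_neighborFinset_eq_degree (G.comap π), h1, Finset.card_biUnion,
      ← SimpleGraph.card_neighborFinset_eq_degree, mul_comm, ← smul_eq_mul]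
    · exact Finset.card_nsmul_le_sum _ _ _ fun v _ => hB v
    · intro v _ v' _ hne
      refine Finset.disjoint_filter.2 fun w' _ h h' => hne (h.symm.trans h')
  calc B ^ 2 * ∑ v, G.degree v = B * ∑ v, B * G.degree v := by 
        rw [← Finset.mul_sum, ← mul_assoc, sq]
    _ ≤ B * ∑ v, (Finset.univ.filter fun w => π w = v).card * G.degree v :=
        Nat.mul_le_mul_left _ (Finset.sum_le_sum fun v _ => Nat.mul_le_mul_right _ (hB v))
    _ = B * ∑ w, G.degree (π w) := by
        rw [← Finset.sum_fiberwise (s := Finset.univ) (g := π) (f := fun w => G.degree (π w))]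
        congr 1
        refine Finset.sum_congr rfl fun v _ => ?_
        rw [← smul_eq_mul, ← Finset.sum_const]
        exact Finset.sum_congr rfl fun w hw => by rw [(Finset.mem_filter.1 hw).2]
    _ ≤ _ := by
        rw [Finset.mul_sum]
        exact Finset.sum_le_sum fun w _ => hdeg w

/-- The residue modulo `|V|` splits `Fin n` into `|V|` classes of nearly equal sizes. -/
theorem exists_balanced_map {V : Type*} [Fintype V] [Nonempty V] [DecidableEq V] (n : ℕ) :
    ∃ π : Fin n → V, ∀ v, n / Fintype.card V ≤ (Finset.univ.filter fun i => π i = v).card ∧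
      (Finset.univ.filter fun i => π i = v).card ≤ n / Fintype.card V + 1 := by
  set N := Fintype.card V with hN
  have hNpos : 0 < N := Fintype.card_pos
  let e := Fintype.equivFin V
  refine ⟨fun i => e.symm ⟨i % N, Nat.mod_lt _ hNpos⟩, fun v => ?_⟩
  have h1 : (Finset.univ.filter fun i : Fin n => e.symm ⟨i % N, Nat.mod_lt _ hNpos⟩ = v).card =
      n.count (· ≡ (e v : ℕ) [MOD N]) := by
    rw [Nat.count_eq_card_filter_range]
    refine Finset.card_bij (fun i _ => (i : ℕ)) ?_ (fun _ _ _ _ h => Fin.ext h) ?_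
    · intro i hi
      have := (Finset.mem_filter.1 hi).2
      rw [Equiv.symm_apply_eq, Fin.ext_iff] at this
      refine Finset.mem_filter.2 ⟨Finset.mem_range.2 i.2, ?_⟩
      change (i : ℕ) % N = e v % N
      rw [Nat.mod_eq_of_lt (e v).2]
      exact this
    · intro i hi
      obtain ⟨hin, himod⟩ := Finset.mem_filter.1 hi
      have himod : i % N = e v % N := himod
      rw [Nat.mod_eq_of_lt (e v).2] at himod
      refine ⟨⟨i, Finset.mem_range.1 hin⟩, ?_, rfl⟩
      simp only [Finset.mem_filter, Finset.mem_univ, true_and, Equiv.symm_apply_eq, Fin.ext_iff]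
      exact himod
  rw [h1, Nat.count_modEq_card n hNpos]
  split_ifs <;> omega

/-! ### Blow-ups and asymptotics -/

/-- Blowing up a graph on `N ≤ n` vertices with `α_s ≤ M` to `n` vertices multiplies `α_s` by at most
`2 * n / N` and leaves at least `n ^ 2 / (64 * M)` edges. -/
theorem exists_blowup {V : Type*} [Fintype V] [Nonempty V] {G₀ : SimpleGraph V} {s M n : ℕ}
    (hs : 2 ≤ s) (hG₀ : G₀.CliqueFree (s + 1)) (hα : sIndepNum s G₀ ≤ M) (hM : 1 ≤ M)
    (hMV : 2 * M ≤ Fintype.card V) (hn : Fintype.card V ≤ n) :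
    ∃ G : SimpleGraph (Fin n), G.CliqueFree (s + 1) ∧
      (sIndepNum s G : ℝ) ≤ 2 * n * M / Fintype.card V ∧
      (n : ℝ) ^ 2 / (64 * M) ≤ G.edgeSet.ncard := by
  classical
  obtain ⟨π, hπ⟩ := exists_balanced_map (V := V) n
  have hindep : ∀ I : Finset V, (∀ x ∈ I, ∀ y ∈ I, ¬ G₀.Adj x y) → I.card ≤ M := fun I hI =>
    (card_le_sIndepNum (((SimpleGraph.cliqueFreeOn_two G₀).2
      fun x hx y hy _ => hI x hx y hy).mono G₀ hs)).trans hα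
  set N := Fintype.card V with hN
  have hNpos : 0 < N := Fintype.card_pos
  have hd : 2 * (M * (N / (2 * M))) ≤ N := by
    rw [← mul_assoc]
    exact Nat.mul_div_le _ _
  have hsum₀ := mul_card_le_two_mul_sum_degree G₀ hindep hd
  have hsum := sq_mul_sum_degree_le_sum_degree_comap (G := G₀) π fun v => (hπ v).1
  have hαG := sIndepNum_comap_le (G := G₀) (s := s) π fun v => (hπ v).2
  rw [sum_degree_eq_two_mul_ncard (G₀.comap π)] at hsum
  have hNR : (0 : ℝ) < N := by exact_mod_cast hNpos
  have hMR : (0 : ℝ) < M := by exact_mod_cast hM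
  have hNn : (N : ℝ) ≤ n := by exact_mod_cast hn
  -- Rounding a quotient that is at least `1` down loses at most a factor `2`.
  have half : ∀ a c : ℕ, 0 < c → c ≤ a → (a : ℝ) / (2 * c) ≤ (a / c : ℕ) := by
    intro a c hc hac
    have hcR : (0 : ℝ) < c := by exact_mod_cast hc
    rw [div_le_iff₀ (by positivity)]
    have h1 := Nat.lt_mul_div_succ a hc
    have h2 : 1 ≤ a / c := (Nat.one_le_div_iff hc).2 hac
    have h3 : a ≤ (a / c) * (2 * c) := by nlinarith
    exact_mod_cast h3
  have hb := half n N hNpos hn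
  have hdR := half N (2 * M) (by omega) hMV
  refine ⟨G₀.comap π, cliqueFree_comap hG₀ π, ?_, ?_⟩
  · have h1 : (sIndepNum s (G₀.comap π) : ℝ) ≤ ((n / N : ℕ) + 1) * M := by
      exact_mod_cast hαG.trans (Nat.mul_le_mul_left _ hα)
    have h2 : ((n / N : ℕ) : ℝ) ≤ n / N := Nat.cast_div_le
    have h3 : (1 : ℝ) ≤ n / N := (one_le_div hNR).2 hNn
    calc _ ≤ _ := h1
      _ ≤ (n / N + n / N) * M := by gcongr
      _ = _ := by ring
  · have hsum₀' : ((N / (2 * M) : ℕ) : ℝ) * N ≤ 2 * (∑ v, G₀.degree v : ℕ) := by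
      exact_mod_cast hsum₀
    have hsum' : ((n / N : ℕ) : ℝ) ^ 2 * (∑ v, G₀.degree v : ℕ) ≤
        2 * (G₀.comap π).edgeSet.ncard := by exact_mod_cast hsum
    set D : ℝ := ((∑ v, G₀.degree v : ℕ) : ℝ)
    have hD : (N : ℝ) ^ 2 / (8 * M) ≤ D := by
      have : (N : ℝ) / (2 * (2 * M : ℕ)) * N ≤ 2 * D :=
        (mul_le_mul_of_nonneg_right hdR hNR.le).trans hsum₀'
      push_cast at this
      calc (N : ℝ) ^ 2 / (8 * M) = (N : ℝ) / (2 * (2 * M)) * N / 2 := by field_simp; norm_num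
        _ ≤ D := by linarith
    have h4 : ((n : ℝ) / (2 * N)) ^ 2 * ((N : ℝ) ^ 2 / (8 * M)) ≤
        2 * (G₀.comap π).edgeSet.ncard := by
      refine le_trans ?_ hsum'
      gcongr
    have h5 : ((n : ℝ) / (2 * N)) ^ 2 * ((N : ℝ) ^ 2 / (8 * M)) = 2 * ((n : ℝ) ^ 2 / (64 * M)) := by
      field_simp; ring
    linarith

/-- The failure probability for `K_s`-free sets is below `1 / 2` once `k` dominates `s * log p`. -/
theorem two_mul_pow_lt_of_mul_log_le {p k s m : ℕ} (hp : 1 ≤ p) (hs : 1 ≤ s) (hm : 1 ≤ m)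
    (h : (s : ℝ) * (1 + 2 * Real.log p + s) ≤ k) :
    2 * ((p ^ 2) ^ m * s ^ m * (s - 1) ^ (m * k)) < s ^ (m * k) := by
  have hsR : (0 : ℝ) < s := by exact_mod_cast hs
  have hpR : (0 : ℝ) < p := by exact_mod_cast hp
  have hmR : (1 : ℝ) ≤ m := by exact_mod_cast hm
  have h1 : ((p : ℝ) ^ 2) ^ m = Real.exp (m * (2 * Real.log p)) := by
    rw [Real.exp_nat_mul, two_mul, Real.exp_add, Real.exp_log hpR, sq]
  have h2 : (s : ℝ) ^ m ≤ Real.exp (m * s) := by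
    rw [Real.exp_nat_mul]
    exact pow_le_pow_left₀ hsR.le ((by linarith : (s : ℝ) ≤ s + 1).trans (Real.add_one_le_exp _)) _
  have h3 : ((s - 1 : ℕ) : ℝ) ^ (m * k) ≤ (s : ℝ) ^ (m * k) * Real.exp (-(m * (k / s))) := by
    have : ((s - 1 : ℕ) : ℝ) ≤ s * Real.exp (-(1 / s)) := by
      have h4 := Real.add_one_le_exp (-(1 / (s : ℝ)))
      rw [Nat.cast_sub hs]
      calc ((s : ℝ) - (1 : ℕ)) = s * (-(1 / s) + 1) := by field_simp; push_cast; ring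
        _ ≤ _ := mul_le_mul_of_nonneg_left h4 hsR.le
    calc _ ≤ ((s : ℝ) * Real.exp (-(1 / s))) ^ (m * k) := pow_le_pow_left₀ (Nat.cast_nonneg _) this _
      _ = _ := by
        rw [mul_pow, ← Real.exp_nat_mul]
        congr 2
        push_cast
        ring
  have h4 : (2 : ℝ) < Real.exp m := by
    have := Real.exp_one_gt_d9
    have := Real.exp_le_exp.2 hmR
    linarith
  have h5 : (m : ℝ) + (m * (2 * Real.log p) + m * s - m * (k / s)) ≤ 0 := by
    have : (1 + 2 * Real.log p + s) ≤ k / s := by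
      rw [le_div_iff₀ hsR]; linarith
    nlinarith
  have hpos : (0 : ℝ) < (s : ℝ) ^ (m * k) := by positivity
  have key : (2 : ℝ) * (((p : ℝ) ^ 2) ^ m * (s : ℝ) ^ m * ((s - 1 : ℕ) : ℝ) ^ (m * k)) <
      (s : ℝ) ^ (m * k) := by
    calc _ ≤ 2 * (Real.exp (m * (2 * Real.log p)) * Real.exp (m * s) *
          ((s : ℝ) ^ (m * k) * Real.exp (-(m * (k / s))))) := by
          rw [h1]; gcongr
      _ = 2 * (Real.exp (m * (2 * Real.log p) + m * s - m * (k / s)) * (s : ℝ) ^ (m * k)) := by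
          rw [sub_eq_add_neg, Real.exp_add, Real.exp_add]; ring
      _ < Real.exp m * (Real.exp (m * (2 * Real.log p) + m * s - m * (k / s)) *
          (s : ℝ) ^ (m * k)) := by
          refine mul_lt_mul_of_pos_right h4 (by positivity)
      _ = Real.exp (m + (m * (2 * Real.log p) + m * s - m * (k / s))) * (s : ℝ) ^ (m * k) := by
          rw [Real.exp_add (m : ℝ)]; ring
      _ ≤ 1 * (s : ℝ) ^ (m * k) := by
          gcongr
          exact Real.exp_le_one_iff.2 h5
      _ = _ := one_mul _
  exact_mod_cast key

/-- The random construction with `k = ⌈p ^ κ⌉` slopes, `b = k ^ 4` clusters and `m = k * p * b`. -/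
theorem eventually_exists_cliqueFree_sIndepNum_le {κ : ℝ} (hκ : 0 < κ) (hκ' : κ < 1) {s : ℕ}
    (hs : 2 ≤ s) (hsκ : 7 ≤ κ * s) :
    ∀ᶠ p : ℕ in atTop, p.Prime → ∃ G : SimpleGraph (ZMod p × ZMod p), G.CliqueFree (s + 1) ∧
      ∃ M : ℕ, 1 ≤ M ∧ sIndepNum s G ≤ M ∧ (M : ℝ) ≤ 32 * (p : ℝ) ^ (1 + 5 * κ) := by
  have hlog : ∀ᶠ x : ℝ in atTop, (s : ℝ) * (1 + 2 * Real.log x + s) ≤ x ^ κ := by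
    have h1 : (fun x : ℝ => (s : ℝ) * (1 + 2 * Real.log x + s)) =o[atTop] fun x => x ^ κ := by
      have hc : ∀ c : ℝ, (fun _ : ℝ => c) =o[atTop] fun x : ℝ => x ^ κ := fun c =>
        isLittleO_const_left.2 (Or.inr (tendsto_norm_atTop_atTop.comp (tendsto_rpow_atTop hκ)))
      exact (((hc 1).add ((isLittleO_log_rpow_atTop hκ).const_mul_left 2)).add
        (hc s)).const_mul_left _
    filter_upwards [h1.bound one_pos, eventually_ge_atTop 0] with x hx hx0
    rw [one_mul, Real.norm_of_nonneg (Real.rpow_nonneg hx0 κ)] at hx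
    exact (le_abs_self _).trans hx
  have hkp : ∀ᶠ x : ℝ in atTop, 2 * x ^ κ ≤ x := by
    filter_upwards [(tendsto_rpow_atTop (sub_pos.2 hκ')).eventually_ge_atTop 2,
      eventually_gt_atTop 0] with x hx hx0
    calc 2 * x ^ κ ≤ x ^ (1 - κ) * x ^ κ := by gcongr
      _ = x := by rw [← Real.rpow_add hx0]; norm_num
  filter_upwards [tendsto_natCast_atTop_atTop.eventually hlog,
    tendsto_natCast_atTop_atTop.eventually hkp, eventually_ge_atTop 3] with p hlog hkp hp3 hp
  have : Fact p.Prime := ⟨hp⟩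
  have hp1 : (1 : ℝ) ≤ p := by exact_mod_cast hp.one_le
  have hpκ : 1 ≤ (p : ℝ) ^ κ := Real.one_le_rpow hp1 hκ.le
  set k := ⌈(p : ℝ) ^ κ⌉₊ with hk
  have hk_ge : (p : ℝ) ^ κ ≤ k := Nat.le_ceil _
  have hk_le : (k : ℝ) ≤ 2 * (p : ℝ) ^ κ := by
    have := (Nat.ceil_lt_add_one (by positivity : 0 ≤ (p : ℝ) ^ κ)).le
    linarith
  have hk1 : 1 ≤ k := Nat.one_le_iff_ne_zero.2 (by
    intro h
    rw [h] at hk_ge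
    norm_num at hk_ge
    linarith)
  have hkpN : k ≤ p := by exact_mod_cast hk_le.trans hkp
  obtain ⟨A, -, hA⟩ := Finset.exists_subset_card_eq
    (show k ≤ (Finset.univ : Finset (ZMod p)).card by rwa [Finset.card_univ, ZMod.card])
  have h₁ : 2 * (Fintype.card (ZMod p) ^ 6 * (A.card ^ 3) ^ s) < (k ^ 4) ^ s := by
    rw [hA, ZMod.card, show (k ^ 4) ^ s = k ^ s * (k ^ 3) ^ s by rw [← mul_pow]; ring_nf,
      ← mul_assoc]
    refine Nat.mul_lt_mul_of_pos_right ?_ (by positivity)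
    -- The hypothesis `7 ≤ κ * s` makes `k ^ s` beat the number of noncollinear triples.
    have h7 : p ^ 7 ≤ k ^ s := by
      have : (p : ℝ) ^ 7 ≤ (k : ℝ) ^ s := by
        calc (p : ℝ) ^ 7 = (p : ℝ) ^ (7 : ℝ) := by norm_cast
          _ ≤ (p : ℝ) ^ (κ * s) := Real.rpow_le_rpow_of_exponent_le hp1 hsκ
          _ = ((p : ℝ) ^ κ) ^ s := by rw [Real.rpow_mul (by positivity), Real.rpow_natCast]
          _ ≤ _ := pow_le_pow_left₀ (by positivity) hk_ge _
      exact_mod_cast this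
    refine lt_of_lt_of_le ?_ h7
    rw [pow_succ, mul_comm]
    exact Nat.mul_lt_mul_of_pos_left (by omega) (by positivity)
  have h₂ := two_mul_pow_lt_of_mul_log_le (p := p) (k := k) (s := s) (m := k * p * k ^ 4)
    hp.one_le (by omega) (Nat.one_le_iff_ne_zero.2 (by positivity)) (hlog.trans hk_ge)
  obtain ⟨G, hG, hα⟩ := exists_cliqueFree_of_card_bounds (F := ZMod p) (b := k ^ 4)
    (m := k * p * k ^ 4) (by omega : 1 ≤ s) (Nat.one_le_pow _ _ hk1) A h₁
    (by rwa [hA, ZMod.card])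
  refine ⟨G, hG, k * p * k ^ 4, Nat.one_le_iff_ne_zero.2 (by positivity),
    sIndepNum_le fun S hS => (hα S ((induce_cliqueFree_iff_cliqueFreeOn _ _ _).2 hS)).le, ?_⟩
  calc ((k * p * k ^ 4 : ℕ) : ℝ) = p * (k : ℝ) ^ 5 := by push_cast; ring
    _ ≤ p * (2 * (p : ℝ) ^ κ) ^ 5 := by gcongr
    _ = 32 * ((p : ℝ) ^ (1 : ℝ) * ((p : ℝ) ^ κ) ^ (5 : ℕ)) := by rw [Real.rpow_one]; ring
    _ = _ := by
      rw [← Real.rpow_mul_natCast (by positivity), ← Real.rpow_add (by positivity)]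
      congr 2
      push_cast
      ring

theorem eventually_mul_rpow_lt_rpow (C : ℝ) {a b : ℝ} (h : a < b) :
    ∀ᶠ n : ℕ in atTop, C * (n : ℝ) ^ a < (n : ℝ) ^ b := by
  have h1 := (tendsto_rpow_atTop (sub_pos.2 h)).comp (tendsto_natCast_atTop_atTop (R := ℝ))
  filter_upwards [h1.eventually_gt_atTop C, eventually_gt_atTop 0] with n hn hn0
  have hn0 : (0 : ℝ) < n := by exact_mod_cast hn0
  have hn : C < (n : ℝ) ^ (b - a) := hn
  calc C * (n : ℝ) ^ a < (n : ℝ) ^ (b - a) * (n : ℝ) ^ a :=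
        mul_lt_mul_of_pos_right hn (by positivity)
    _ = _ := by rw [← Real.rpow_add hn0]; ring_nf

/-- The blow-up of the random construction for a prime `p` of order `n ^ γ`. -/
theorem eventually_rpow_le_ramseyTuran {κ γ δ : ℝ} (hκ : 0 < κ) (hκ' : 5 * κ < 1) (hγ : 0 < γ)
    (hγ' : γ < 1 / 2) (hδ : 1 - δ < γ * (1 - 5 * κ)) {s : ℕ} (hs : 2 ≤ s) (hsκ : 7 ≤ κ * s) :
    ∀ᶠ n : ℕ in atTop, (n : ℝ) ^ (2 - γ * (1 + 5 * κ)) ≤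
      32768 * ramseyTuran s n (SimpleGraph.completeGraph (Fin (s + 1))) ((n : ℝ) ^ δ) := by
  obtain ⟨p₀, hp₀⟩ := eventually_atTop.1
    (eventually_exists_cliqueFree_sIndepNum_le hκ (by linarith) hs hsκ)
  have hx := ((tendsto_rpow_atTop hγ).comp
    (tendsto_natCast_atTop_atTop (R := ℝ))).eventually_ge_atTop (max p₀ 1 : ℝ)
  filter_upwards [hx, eventually_gt_atTop 0, eventually_mul_rpow_lt_rpow 64 hδ,
    eventually_mul_rpow_lt_rpow 16 (by linarith : 2 * γ < 1),
    eventually_mul_rpow_lt_rpow 64 (by nlinarith : (0 : ℝ) < γ * (1 - 5 * κ))]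
    with n hx hn0 hα hsq hd
  have hn0R : (0 : ℝ) < n := by exact_mod_cast hn0
  have hn1 : (1 : ℝ) ≤ n := by exact_mod_cast hn0
  rw [Function.comp_apply] at hx
  set x := (n : ℝ) ^ γ with hxdef
  have hx1 : 1 ≤ x := (le_max_right _ _).trans hx
  have hxp₀ : (p₀ : ℝ) ≤ x := (le_max_left _ _).trans hx
  -- Bertrand's postulate provides a prime between `x` and `4 * x`.
  obtain ⟨p, hp, hlt, hle⟩ := Nat.exists_prime_lt_and_le_two_mul ⌈x⌉₊
    (Nat.ceil_pos.2 (by linarith)).ne'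
  have hxp : x ≤ p := (Nat.le_ceil x).trans (by exact_mod_cast hlt.le)
  have hpx : (p : ℝ) ≤ 4 * x := by
    have h1 : (p : ℝ) ≤ 2 * ⌈x⌉₊ := by exact_mod_cast hle
    have h2 := (Nat.ceil_lt_add_one (by linarith : 0 ≤ x)).le
    linarith
  have hp0 : (0 : ℝ) < p := by linarith
  have : Fact p.Prime := ⟨hp⟩
  obtain ⟨G₀, hG₀, M, hM1, hM, hMle⟩ := hp₀ p (by exact_mod_cast hxp₀.trans hxp) hp
  have hcard : Fintype.card (ZMod p × ZMod p) = p ^ 2 := by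
    rw [Fintype.card_prod, ZMod.card, sq]
  have hpn : p ^ 2 ≤ n := by
    have : (p : ℝ) ^ 2 ≤ n := by
      calc (p : ℝ) ^ 2 ≤ (4 * x) ^ 2 := by gcongr
        _ = 16 * (n : ℝ) ^ (2 * γ) := by
          rw [mul_pow, hxdef, ← Real.rpow_mul_natCast hn0R.le]
          norm_num [mul_comm]
        _ ≤ n := by simpa using hsq.le
    exact_mod_cast this
  have hxpow : (n : ℝ) ^ (γ * (1 - 5 * κ)) ≤ (p : ℝ) ^ (1 - 5 * κ) := by
    rw [Real.rpow_mul hn0R.le]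
    exact Real.rpow_le_rpow (by linarith) hxp (by linarith)
  have hpsplit : (p : ℝ) ^ 2 = (p : ℝ) ^ (1 + 5 * κ) * (p : ℝ) ^ (1 - 5 * κ) := by
    rw [← Real.rpow_add hp0, ← Real.rpow_natCast]
    norm_num
  have hMp : 2 * M ≤ p ^ 2 := by
    have : (2 : ℝ) * M ≤ (p : ℝ) ^ 2 := by
      rw [Real.rpow_zero, mul_one] at hd
      rw [hpsplit]
      have h0 : (0 : ℝ) < (p : ℝ) ^ (1 + 5 * κ) := by positivity
      nlinarith [mul_le_mul_of_nonneg_left (hd.le.trans hxpow) h0.le]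
    exact_mod_cast this
  obtain ⟨G, hG, hαG, hedge⟩ := exists_blowup hs hG₀ hM hM1 (hcard ▸ hMp) (hcard ▸ hpn)
  have hαlt : (sIndepNum s G : ℝ) < (n : ℝ) ^ δ := by
    refine hαG.trans_lt ?_
    rw [hcard]
    push_cast
    rw [div_lt_iff₀ (by positivity), hpsplit]
    have h0 : (0 : ℝ) < (p : ℝ) ^ (1 + 5 * κ) := by positivity
    have hnδ : (n : ℝ) = (n : ℝ) ^ δ * (n : ℝ) ^ (1 - δ) := by
      rw [← Real.rpow_add hn0R]; norm_num
    calc (2 : ℝ) * n * M ≤ 2 * n * (32 * (p : ℝ) ^ (1 + 5 * κ)) := by gcongr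
      _ = (n : ℝ) ^ δ * ((p : ℝ) ^ (1 + 5 * κ) * (64 * (n : ℝ) ^ (1 - δ))) := by
        rw [show (2 : ℝ) * n * (32 * (p : ℝ) ^ (1 + 5 * κ)) =
          n * ((p : ℝ) ^ (1 + 5 * κ) * 64) by ring]
        nth_rewrite 1 [hnδ]
        ring
      _ < _ := by
        have := hα.trans_le hxpow
        gcongr
  have hRT := le_ramseyTuran ((free_completeGraph_fin_iff G (s + 1)).2 hG) hαlt
  have hRTR : (G.edgeSet.ncard : ℝ) ≤
      ramseyTuran s n (SimpleGraph.completeGraph (Fin (s + 1))) ((n : ℝ) ^ δ) := by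
    exact_mod_cast hRT
  have hppow : (p : ℝ) ^ (1 + 5 * κ) ≤ 16 * (n : ℝ) ^ (γ * (1 + 5 * κ)) := by
    calc (p : ℝ) ^ (1 + 5 * κ) ≤ (4 * x) ^ (1 + 5 * κ) :=
          Real.rpow_le_rpow hp0.le hpx (by linarith)
      _ = 4 ^ (1 + 5 * κ) * (n : ℝ) ^ (γ * (1 + 5 * κ)) := by
          rw [Real.mul_rpow (by norm_num) (by linarith), hxdef, ← Real.rpow_mul hn0R.le]
      _ ≤ 4 ^ (2 : ℝ) * (n : ℝ) ^ (γ * (1 + 5 * κ)) := by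
          gcongr
          · norm_num
          · linarith
      _ = _ := by norm_num
  calc (n : ℝ) ^ (2 - γ * (1 + 5 * κ)) = (n : ℝ) ^ 2 / (n : ℝ) ^ (γ * (1 + 5 * κ)) := by
        rw [Real.rpow_sub hn0R]; norm_num
    _ = 32768 * ((n : ℝ) ^ 2 / (64 * (32 * (16 * (n : ℝ) ^ (γ * (1 + 5 * κ)))))) := by
        field_simp; norm_num
    _ ≤ 32768 * ((n : ℝ) ^ 2 / (64 * M)) := by
        have : (0 : ℝ) < M := by exact_mod_cast hM1
        gcongr
        linarith
    _ ≤ _ := by linarith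

theorem theorem6p1 (ε δ : ℝ) (hε : 0 < ε) (hδ : 1 / 2 < δ) (hδ' : δ < 1) :
    ∀ᶠ s : ℕ in atTop,
      ((fun n : ℕ => (n : ℝ) ^ (1 + δ - ε)) =O[atTop]
        fun n : ℕ => (ramseyTuran s n (SimpleGraph.completeGraph (Fin (s + 1))) ((n : ℝ) ^ δ) : ℝ)) ∧
      ((fun n : ℕ => (ramseyTuran s n (SimpleGraph.completeGraph (Fin (s + 1))) ((n : ℝ) ^ δ) : ℝ))
        =O[atTop] fun n : ℕ => (n : ℝ) ^ (1 + δ)) := by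
  obtain ⟨η, hη, hηε, hηδ⟩ : ∃ η : ℝ, 0 < η ∧ 2 * η ≤ ε ∧ 2 * η ≤ δ - 1 / 2 :=
    ⟨min ε (δ - 1 / 2) / 2, by have := lt_min hε (sub_pos.2 hδ); linarith,
      by linarith [min_le_left ε (δ - 1 / 2)], by linarith [min_le_right ε (δ - 1 / 2)]⟩
  -- The choice `κ = η / 5`, `γ = 1 - δ + η` gives `γ * (1 - 5 * κ) > 1 - δ` and
  -- `γ * (1 + 5 * κ) ≤ 1 - δ + ε`.
  obtain ⟨s₀, hs₀⟩ := exists_nat_ge (7 / (η / 5))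
  filter_upwards [eventually_ge_atTop (max 2 s₀)] with s hs
  have hs₂ : 2 ≤ s := (le_max_left _ _).trans hs
  have hsκ : 7 ≤ η / 5 * s := by
    have h1 : (s₀ : ℝ) ≤ s := by exact_mod_cast (le_max_right _ _).trans hs
    have h2 := hs₀.trans h1
    rw [div_le_iff₀ (by positivity)] at h2
    linarith
  constructor
  · refine IsBigO.of_bound 32768 ?_
    filter_upwards [eventually_rpow_le_ramseyTuran (κ := η / 5) (γ := 1 - δ + η) (δ := δ)
      (by positivity) (by linarith) (by linarith) (by linarith) (by nlinarith) hs₂ hsκ,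
      eventually_ge_atTop 1] with n hn hn1
    rw [Real.norm_of_nonneg (by positivity), Real.norm_of_nonneg (by positivity)]
    refine le_trans (Real.rpow_le_rpow_of_exponent_le (by exact_mod_cast hn1) ?_) hn
    nlinarith
  · refine IsBigO.of_bound 1 ?_
    filter_upwards [eventually_ge_atTop 1] with n hn1
    have hn0 : (0 : ℝ) < n := by exact_mod_cast hn1
    rw [Real.norm_of_nonneg (by positivity), Real.norm_of_nonneg (by positivity), one_mul,
      Real.rpow_add hn0, Real.rpow_one]
    exact ramseyTuran_le (by positivity)
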